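/- **Theorem 2.1.** Let $b>0$. For $c>0$ and $n\ge 1$ put $\varepsilon=b/n$ and consider $n$ intervals of length $\varepsilon$ pushed from the left by a barrier at $ct$, defined as follows. Let $B^1,\dots,B^n$ be independent standard Brownian motions, and let $Z^k$ ($1\le k\le n$) be the process $dZ^k_t=dB^k_t-c\,dt$ reflected at $0$; that is, $Z^k_t=Z^k_0+B^k_t-ct+\ell^k_t\ge 0$, where $\ell^k$ is continuous and nondecreasing, $\ell^k_0=0$ and $\int_0^\infty 1_{\{Z^k_t>0\}}\,d\ell^k_t=0$. Assume that the system starts from the pseudo-stationary distribution: $Z^1_0,\dots,Z^n_0$ are i.i.d., independent of $(B^1,\dots,B^n)$, with the stationary density $2c\,e^{-2cz}$, $z\ge 0$, of $Z^k$. For $t\ge 0$ let $Y^1_t\le\dots\le Y^n_t$ be the values $Z^1_t,\dots,Z^n_t$ in nondecreasing order, and set $$X^k_t=Y^k_t+(k-1)\varepsilon+\varepsilon/2+ct,\qquad I^k_t=(X^k_t-\varepsilon/2,\;X^k_t+\varepsilon/2).$$ For $0\le x<y<\infty$ let $$\mathbf d_t([x,y])=\frac{\lambda\big([x+ct,\,y+ct]\cap\bigcup_{1\le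 k\le n}I^k_t\big)}{y-x},$$ where $\lambda$ is Lebesgue measure. Fix arbitrary $p_1<1$, $d_1<1$, $d_2>0$ and $0\le x_1<x_2<b<x_3<x_4<\infty$. Then there exist $c_0>0$ and $n_0\ge 1$, depending only on $p_1,d_1,d_2,b,x_1,x_2,x_3,x_4$, such that for all $c\ge c_0$, all $n\ge n_0$ and all $t\ge 0$, $$P\big(\mathbf d_t([x_1,x_2])\ge d_1\big)\ge p_1\qquad\text{and}\qquad P\big(\mathbf d_t([x_3,x_4])\le d_2\big)\ge p_1.$$ -/

import Mathlib

open MeasureTheory ProbabilityTheory Set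
open scoped NNReal

namespace Crowding

/-- `z` is the path `x` reflected at `0` (the one-dimensional Skorokhod problem): `z = x + ℓ ≥ 0`,
where `ℓ` is continuous and nondecreasing, `ℓ 0 = 0`, and `∫ 1_{z > 0} dℓ = 0`. The last integral
is taken with respect to the Lebesgue-Stieltjes measure of `ℓ` on `[0, ∞)`. -/
def IsReflectionAtZero (x z : ℝ≥0 → ℝ) : Prop :=
  ∃ ℓ : StieltjesFunction ℝ≥0, Continuous ℓ ∧ ℓ 0 = 0 ∧ (∀ t, z t = x t + ℓ t) ∧
    (∀ t, 0 ≤ z t) ∧ ℓ.measure {t | 0 < z t} = 0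

/-- `Z` is the process `dZ = dB - c dt` reflected at `0`. -/
def IsReflectedDriftedBM {Ω : Type*} [MeasurableSpace Ω] (P : Measure Ω) (c : ℝ)
    (B Z : ℝ≥0 → Ω → ℝ) : Prop :=
  ∀ᵐ ω ∂P, IsReflectionAtZero (fun t => Z 0 ω + B t ω - c * t) (fun t => Z t ω)

/-- The driving family `Z` of the model with `n` particles and barrier speed `c`, started from the
pseudo-stationary distribution: the `B k` are independent Brownian motions, `Z k` solves
`dZ = dB - c dt` reflected at `0`, and the starting points `Z k 0` are independent of each other
and of the Brownian motions, with the stationary distribution of a single `Z k`, whose density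
is `2 c e^{-2 c z}` on `[0, ∞)`. -/
structure IsPseudoStationary {Ω : Type*} [MeasurableSpace Ω] (P : Measure Ω) (c : ℝ) {n : ℕ}
    (B Z : Fin n → ℝ≥0 → Ω → ℝ) : Prop where
  brownian : ∀ k, IsBrownianReal (B k) P
  reflected : ∀ k, IsReflectedDriftedBM P c (B k) (Z k)
  hasLaw_zero : ∀ k, HasLaw (Z k 0) (expMeasure (2 * c)) P
  indep_particles : iIndepFun (fun k ω => (Z k 0 ω, fun t => B k t ω)) P
  indep_start : ∀ k, IndepFun (Z k 0) (fun ω t => B k t ω) P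

/-- The values `v` listed in nondecreasing order. -/
noncomputable def orderStatistics {n : ℕ} (v : Fin n → ℝ) : Fin n → ℝ :=
  v ∘ Tuple.sort v

/-- The center of the `k`-th leftmost particle of length `ε` at time `t`, where `v` is the
configuration of the `Z`'s at time `t`. As `k` runs from `0` to `n - 1`, the shift is `k ε`. -/
noncomputable def center {n : ℕ} (c ε : ℝ) (t : ℝ≥0) (v : Fin n → ℝ) (k : Fin n) : ℝ :=
  orderStatistics v k + (k : ℕ) * ε + ε / 2 + c * t

/-- The `k`-th leftmost particle, an open interval of length `ε`. -/
noncomputable def particle {n : ℕ} (c ε : ℝ) (t : ℝ≥0) (v : Fin n → ℝ) (k : Fin n) : Set ℝ :=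
  Ioo (center c ε t v k - ε / 2) (center c ε t v k + ε / 2)

/-- The mass density `d_t([x, y])`, in the frame moving with the barrier. -/
noncomputable def massDensity {n : ℕ} (c ε : ℝ) (t : ℝ≥0) (v : Fin n → ℝ) (x y : ℝ) : ℝ :=
  volume.real (Icc (x + c * t) (y + c * t) ∩ ⋃ k, particle c ε t v k) / (y - x)

end Crowding

namespace Crowding

/-! Each `Z k t` has tail at most `2 exp(-2ca)`, uniformly in `t`. Since its last zero, or since
time `0`, a reflected path moves freely. So `Z k t > a` forces either the free motion from the
exponential start or some backward increment of drifted Brownian motion to exceed `a`. Both have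
tail at most `exp(-2ca)`, because rate `2c` is preserved by a Gaussian step with drift
(`measure_lt_add_gaussian_le`) and by reflection along a grid (`measure_lt_lindley_le`).

Markov's inequality then puts at least `(1 - η) n` values below `δ` with high probability once `c`
is large (`measure_configuration_ge`). The rest is deterministic: in the moving frame these
particles fill `[0, (1 - η) b]` up to gaps of total length at most `δ` and stay left of `b + δ`; the
others have total length at most `η b`. -/

/-! ### Reflected paths -/

/-- A continuous path reflected at `0` either has never touched `0` before `t`, or it moves freely
since its last visit `s` to `0`. -/
lemma IsReflectionAtZero.exists_last_zero {x z : ℝ≥0 → ℝ} (h : IsReflectionAtZero x z)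
    (hx : Continuous x) (t : ℝ≥0) :
    ∃ s ≤ t, (s = 0 ∨ z s = 0) ∧ z t = z s + (x t - x s) := by
  obtain ⟨ℓ, hℓ, -, hz, hz0, hm⟩ := h
  have hzc : Continuous z := by
    rw [show z = fun t => x t + ℓ t from funext hz]
    exact hx.add hℓ
  have key : ∀ s ≤ t, (∀ r ∈ Ioc s t, z r ≠ 0) → z t = z s + (x t - x s) := by
    intro s hst hr
    -- `ℓ` charges only the zeros of `z`, so it is constant on `[s, t]`.
    have h0 : ℓ.measure (Ioc s t) = 0 :=
      measure_mono_null (fun r hrs => (hz0 r).lt_of_ne' (hr r hrs)) hm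
    rw [StieltjesFunction.measure_Ioc, ENNReal.ofReal_eq_zero] at h0
    have := ℓ.mono hst
    rw [hz t, hz s]
    linarith
  rcases (Icc 0 t ∩ {s | z s = 0}).eq_empty_or_nonempty with he | hne
  · refine ⟨0, zero_le, Or.inl rfl, key 0 zero_le fun r hr hr0 => ?_⟩
    exact (he ▸ notMem_empty r) ⟨⟨zero_le, hr.2⟩, hr0⟩
  · have hc : IsCompact (Icc 0 t ∩ {s | z s = 0}) :=
      isCompact_Icc.inter_right (isClosed_eq hzc continuous_const)
    obtain ⟨s, hs, hmax⟩ := hc.exists_isGreatest hne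
    refine ⟨s, hs.1.2, Or.inr hs.2, key s hs.1.2 fun r hr hr0 => ?_⟩
    exact hr.1.not_ge (hmax ⟨⟨zero_le, hr.2⟩, hr0⟩)

/-! ### Exponential tails for drifted Brownian motion -/

variable {Ω : Type*} [MeasurableSpace Ω] {P : Measure Ω}

/-- The exponential tail bound with rate `2 c` is preserved by adding an independent Gaussian
increment of variance `v` and mean `-c v`. -/
lemma measure_lt_add_gaussian_le [IsProbabilityMeasure P] {c : ℝ} {v : ℝ≥0} {W ξ : Ω → ℝ}
    (hW : AEMeasurable W P) (hξ : HasLaw ξ (gaussianReal 0 v) P) (hind : IndepFun W ξ P)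
    (htail : ∀ a, P {ω | a < W ω} ≤ ENNReal.ofReal (Real.exp (-(2 * c * a)))) (a : ℝ) :
    P {ω | a < W ω + ξ ω - c * v} ≤ ENNReal.ofReal (Real.exp (-(2 * c * a))) := by
  have hprod := (indepFun_iff_map_prod_eq_prod_map_map hW hξ.aemeasurable).1 hind
  have hms : MeasurableSet {p : ℝ × ℝ | a < p.1 + p.2 - c * v} :=
    measurableSet_lt (by fun_prop) (by fun_prop)
  -- The factor `exp(2c²v)` is cancelled exactly by the drift `-cv`; this singles out the rate `2c`.
  have hmgf : ∫⁻ x, ENNReal.ofReal (Real.exp (2 * c * x)) ∂(gaussianReal 0 v)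
      = ENNReal.ofReal (Real.exp (v * (2 * c) ^ 2 / 2)) := by
    rw [← ofReal_integral_eq_lintegral_ofReal (integrable_exp_mul_gaussianReal _)
      (Filter.Eventually.of_forall fun _ => (Real.exp_pos _).le)]
    have := mgf_gaussianReal (p := gaussianReal 0 v) (X := id) (μ := 0) (v := v)
      Measure.map_id (2 * c)
    rw [mgf] at this
    simp only [id_eq, zero_mul, zero_add] at this
    rw [this]
  have := Measure.isProbabilityMeasure_map (μ := P) hW
  calc P {ω | a < W ω + ξ ω - c * v}
      = P.map (fun ω => (W ω, ξ ω)) {p : ℝ × ℝ | a < p.1 + p.2 - c * v} := by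
        rw [Measure.map_apply_of_aemeasurable (hW.prodMk hξ.aemeasurable) hms]
        rfl
    _ = ∫⁻ x, P.map W {w | a < w + x - c * v} ∂(gaussianReal 0 v) := by
        rw [hprod, hξ.map_eq, Measure.prod_apply_symm hms]
        rfl
    _ ≤ ∫⁻ x, ENNReal.ofReal (Real.exp (-(2 * c * a) - 2 * c ^ 2 * v)) *
          ENNReal.ofReal (Real.exp (2 * c * x)) ∂(gaussianReal 0 v) := by
        refine lintegral_mono fun x => ?_
        rw [Measure.map_apply_of_aemeasurable hW (measurableSet_lt (by fun_prop) (by fun_prop)),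
          ← ENNReal.ofReal_mul (Real.exp_pos _).le, ← Real.exp_add]
        refine (measure_mono fun ω hω => ?_).trans ((htail (a + c * v - x)).trans_eq ?_)
        · simp only [mem_preimage, mem_ofPred_eq] at hω ⊢
          linarith
        · congr 2
          ring
    _ = ENNReal.ofReal (Real.exp (-(2 * c * a))) := by
        rw [lintegral_const_mul _ (by fun_prop), hmgf, ← ENNReal.ofReal_mul (Real.exp_pos _).le,
          ← Real.exp_add]
        congr 2
        ring

/-- Lindley's recursion: the path `x` sampled at the times `τ 0, τ 1, …` and reflected at `0`. -/
noncomputable def lindley (τ : ℕ → ℝ≥0) (x : ℝ≥0 → ℝ) : ℕ → ℝ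
  | 0 => 0
  | i + 1 => max (lindley τ x i + (x (τ (i + 1)) - x (τ i))) 0

lemma lindley_nonneg (τ : ℕ → ℝ≥0) (x : ℝ≥0 → ℝ) : ∀ i, 0 ≤ lindley τ x i
  | 0 => le_rfl
  | _ + 1 => le_max_right _ _

/-- Reflection only pushes upwards, so one Lindley variable controls all backward increments on the
grid. -/
lemma sub_le_lindley (τ : ℕ → ℝ≥0) (x : ℝ≥0 → ℝ) {i j : ℕ} (hij : i ≤ j) :
    x (τ j) - x (τ i) ≤ lindley τ x j := by
  induction j, hij using Nat.le_induction with
  | base => simpa using lindley_nonneg τ x i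
  | succ j _ ih =>
    refine le_trans ?_ (le_max_left _ _)
    linarith

lemma lindley_congr {τ : ℕ → ℝ≥0} {x y : ℝ≥0 → ℝ} {i : ℕ} (h : ∀ j ≤ i, x (τ j) = y (τ j)) :
    lindley τ x i = lindley τ y i := by
  induction i with
  | zero => rfl
  | succ i ih =>
    simp only [lindley]
    rw [ih fun j hj => h j (hj.trans i.le_succ), h _ le_rfl, h _ i.le_succ]

lemma measurable_lindley {α : Type*} [MeasurableSpace α] (τ : ℕ → ℝ≥0) {X : α → ℝ≥0 → ℝ}
    (hX : ∀ t, Measurable fun a => X a t) (i : ℕ) : Measurable fun a => lindley τ (X a) i := by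
  induction i with
  | zero => exact measurable_const
  | succ i ih => exact (ih.add ((hX _).sub (hX _))).max measurable_const

lemma aemeasurable_lindley (τ : ℕ → ℝ≥0) {X : Ω → ℝ≥0 → ℝ}
    (hX : ∀ t, AEMeasurable (fun a => X a t) P) (i : ℕ) :
    AEMeasurable (fun a => lindley τ (X a) i) P := by
  induction i with
  | zero => exact aemeasurable_const
  | succ i ih => exact (ih.add ((hX _).sub (hX _))).max aemeasurable_const

/-- A drifted Brownian motion reflected along a grid has an exponential tail. -/
lemma measure_lt_lindley_le [IsProbabilityMeasure P] {B : ℝ≥0 → Ω → ℝ}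
    (hB : IsPreBrownianReal B P) {c : ℝ} (hc : 0 ≤ c) {τ : ℕ → ℝ≥0} (hτ : Monotone τ)
    (i : ℕ) (a : ℝ) :
    P {ω | a < lindley τ (fun t => B t ω - c * t) i} ≤
      ENNReal.ofReal (Real.exp (-(2 * c * a))) := by
  -- For `a < 0` the bound exceeds `1`; for `a ≥ 0` the maximum with `0` does not affect the event.
  have hneg : ∀ a < 0, ∀ s : Set Ω, P s ≤ ENNReal.ofReal (Real.exp (-(2 * c * a))) := by
    intro a ha s
    refine prob_le_one.trans (ENNReal.one_le_ofReal.2 (Real.one_le_exp ?_))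
    nlinarith
  induction i generalizing a with
  | zero =>
    rcases lt_or_ge a 0 with ha | ha
    · exact hneg a ha _
    · simp [lindley, ha.not_gt]
  | succ i ih =>
    rcases lt_or_ge a 0 with ha | ha
    · exact hneg a ha _
    have hle : τ i ≤ τ (i + 1) := hτ i.le_succ
    have hlaw : HasLaw (fun ω => B (τ i + (τ (i + 1) - τ i)) ω - B (τ i) ω)
        (gaussianReal 0 (τ (i + 1) - τ i)) P := (hB.shift (τ i)).hasLaw_eval _
    have hind : IndepFun (fun ω => lindley τ (fun t => B t ω - c * t) i)
        (fun ω => B (τ i + (τ (i + 1) - τ i)) ω - B (τ i) ω) P := by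
      classical
      -- The Lindley variable is a function of the path up to `τ i`; the default value `0` after
      -- that time is never read.
      have h := (hB.indepFun_shift (τ i)).symm.comp
        (_mγ := Real.measurableSpace) (φ := fun y : Iic (τ i) → ℝ =>
          lindley τ (fun t => (if ht : t ≤ τ i then y ⟨t, ht⟩ else 0) - c * t) i)
        (ψ := fun y : ℝ≥0 → ℝ => y (τ (i + 1) - τ i)) ?_ (measurable_pi_apply (X := fun _ : ℝ≥0 => ℝ) _)
      · convert h using 1
        · ext ω
          refine lindley_congr fun j hj => ?_
          simp [hτ hj]
        · rfl
      · refine measurable_lindley τ (X := fun y : Iic (τ i) → ℝ =>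
          fun t => (if ht : t ≤ τ i then y ⟨t, ht⟩ else 0) - c * t) (fun t => ?_) i
        by_cases ht : t ≤ τ i
        · simp only [ht, dite_true]
          fun_prop
        · simp only [ht, dite_false]
          fun_prop
    have hW := aemeasurable_lindley (P := P) τ (X := fun ω t => B t ω - c * t)
      (fun t => (hB.aemeasurable t).sub_const _) i
    refine (measure_mono fun ω hω => ?_).trans (measure_lt_add_gaussian_le hW hlaw hind ih a)
    simp only [lindley, mem_ofPred_eq, lt_max_iff, ha.not_gt, or_false,
      add_tsub_cancel_of_le hle, NNReal.coe_sub hle] at hω ⊢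
    linarith

open Filter Topology in
/-- The running maximum of a drifted Brownian motion seen backwards from time `t` has an
exponential tail. -/
lemma measure_exists_lt_sub_le [IsProbabilityMeasure P] {B : ℝ≥0 → Ω → ℝ}
    (hB : IsPreBrownianReal B P) {c : ℝ} (hc : 0 ≤ c) (t : ℝ≥0) (a : ℝ) :
    P {ω | Continuous (fun s => B s ω) ∧
        ∃ s ≤ t, a < (B t ω - c * t) - (B s ω - c * s)} ≤
      ENNReal.ofReal (Real.exp (-(2 * c * a))) := by
  set τ : ℕ → ℕ → ℝ≥0 := fun N i => t * (i / (N + 1)) with hτdef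
  have hτ : ∀ N, Monotone (τ N) := fun N i j hij => by
    simp only [hτdef]
    gcongr
  have hτN : ∀ N, τ N (N + 1) = t := fun N => by
    simp only [hτdef]
    push_cast
    rw [div_self (by positivity), mul_one]
  set A : ℕ → Set Ω := fun N => {ω | a < lindley (τ N) (fun s => B s ω - c * s) (N + 1)}
  have hA : ∀ N, P (A N) ≤ ENNReal.ofReal (Real.exp (-(2 * c * a))) := fun N =>
    measure_lt_lindley_le hB hc (hτ N) (N + 1) a
  -- The grids only approximate `s`, so the event lies in the liminf of the `A N`, which inherits
  -- their common bound.
  have hmono : Monotone fun M => ⋂ N ≥ M, A N := fun M M' h =>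
    biInter_subset_biInter_left fun _ hN => h.trans hN
  calc _ ≤ P (⋃ M, ⋂ N ≥ M, A N) := by
        refine measure_mono ?_
        rintro ω ⟨hcont, s, hst, hs⟩
        have hgrid : Tendsto (fun N : ℕ => τ N ⌊((s / t : ℝ≥0) : ℝ) * (N + 1)⌋₊) atTop (𝓝 s) := by
          have hst' : t * (s / t) = s :=
            mul_div_cancel_of_imp' fun ht => le_antisymm (hst.trans_eq ht) zero_le
          have hlim := (tendsto_nat_floor_mul_div_atTop (R := ℝ) (s / t).coe_nonneg).comp
            (tendsto_natCast_atTop_atTop.comp (tendsto_add_atTop_nat 1))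
          rw [← NNReal.tendsto_coe]
          convert hlim.const_mul (t : ℝ) using 1
          · ext N
            simp only [hτdef, Function.comp_apply, NNReal.coe_mul, NNReal.coe_div,
              NNReal.coe_add, NNReal.coe_natCast, NNReal.coe_one, Nat.cast_add, Nat.cast_one]
          · rw [← NNReal.coe_mul, hst']
        have hev := ((((hcont.sub (continuous_const.mul NNReal.continuous_coe)).tendsto s).comp
          hgrid).const_sub (B t ω - c * t)).eventually (lt_mem_nhds hs)
        obtain ⟨M, hM⟩ := eventually_atTop.1 hev
        refine mem_iUnion.2 ⟨M, mem_iInter₂.2 fun N hN => ?_⟩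
        refine (hM N hN).trans_le ?_
        have hfl : ⌊((s / t : ℝ≥0) : ℝ) * (N + 1)⌋₊ ≤ N + 1 := by
          refine Nat.floor_le_of_le ?_
          push_cast
          exact mul_le_of_le_one_left (by positivity)
            (div_le_one_of_le₀ (NNReal.coe_le_coe.2 hst) t.coe_nonneg)
        have := sub_le_lindley (τ N) (fun s => B s ω - c * s) hfl
        rwa [hτN] at this
    _ = ⨆ M, P (⋂ N ≥ M, A N) := hmono.measure_iUnion
    _ ≤ _ := iSup_le fun M => (measure_mono (biInter_subset_of_mem le_rfl)).trans (hA M)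

/-! ### Order statistics and covered length -/

lemma monotone_orderStatistics {n : ℕ} (v : Fin n → ℝ) : Monotone (orderStatistics v) :=
  Tuple.monotone_sort v

lemma orderStatistics_le_iff {n : ℕ} (v : Fin n → ℝ) (a : ℝ) (k : Fin n) :
    orderStatistics v k ≤ a ↔ (k : ℕ) < (Finset.univ.filter fun i => v i ≤ a).card := by
  rw [← Tuple.lt_card_le_iff_apply_le_of_monotone (monotone_orderStatistics v)]
  have : (Finset.univ.filter fun i => orderStatistics v i ≤ a).card =
      (Finset.univ.filter fun i => v i ≤ a).card :=
    Finset.card_equiv (Tuple.sort v) fun i => by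
      simp only [Finset.mem_filter, Finset.mem_univ, true_and]
      rfl
  rw [this]

section Geometry

variable {n : ℕ} {c ε : ℝ} {t : ℝ≥0} {v : Fin n → ℝ}

lemma particle_eq (c ε : ℝ) (t : ℝ≥0) (v : Fin n → ℝ) (k : Fin n) :
    particle c ε t v k = Ioo (orderStatistics v k + (k : ℕ) * ε + c * t)
      (orderStatistics v k + ((k : ℕ) + 1) * ε + c * t) := by
  rw [particle, center]
  congr 1 <;> ring

lemma volume_particle (c ε : ℝ) (t : ℝ≥0) (v : Fin n → ℝ) (k : Fin n) :
    volume (particle c ε t v k) = ENNReal.ofReal ε := by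
  rw [particle, Real.volume_Ioo]
  congr 1
  ring

lemma measurableSet_particle (c ε : ℝ) (t : ℝ≥0) (v : Fin n → ℝ) (k : Fin n) :
    MeasurableSet (particle c ε t v k) :=
  measurableSet_Ioo

open Function in
lemma pairwise_disjoint_particle (hε : 0 ≤ ε) : Pairwise (Disjoint on particle c ε t v) := by
  refine (pairwise_disjoint_on _).2 fun i j hij => disjoint_left.2 fun z hi hj => ?_
  rw [particle_eq] at hi hj
  have h1 := monotone_orderStatistics v hij.le
  have h2 : (((i : ℕ) : ℝ) + 1) * ε ≤ (j : ℕ) * ε := by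
    gcongr
    exact_mod_cast hij
  linarith [hi.2, hj.1]

lemma volume_biUnion_particle (hε : 0 ≤ ε) (s : Finset (Fin n)) :
    volume.real (⋃ k ∈ s, particle c ε t v k) = s.card * ε := by
  rw [measureReal_def, measure_biUnion_finset (fun i _ j _ hij => pairwise_disjoint_particle hε hij)
    fun k _ => measurableSet_particle c ε t v k]
  simp [volume_particle, hε]

lemma card_lt_card_filter_le (a : ℝ) (v : Fin n → ℝ) :
    (Finset.univ.filter fun k : Fin n =>
      (k : ℕ) < (Finset.univ.filter fun i => v i ≤ a).card).card =
      (Finset.univ.filter fun i => v i ≤ a).card := by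
  rw [Fin.card_filter_val_lt, min_eq_right]
  simpa using Finset.card_filter_le Finset.univ fun i => v i ≤ a

/-- If all but few values are at most `δ`, then the particles cover most of `[x, y]`. -/
lemma le_massDensity {x y δ : ℝ} (hε : 0 ≤ ε) (hδ : 0 ≤ δ) (hv : ∀ k, 0 ≤ v k) (hx : 0 ≤ x)
    (hxy : x < y) (hy : y ≤ (Finset.univ.filter fun i => v i ≤ δ).card * ε) :
    1 - δ / (y - x) ≤ massDensity c ε t v x y := by
  set m := (Finset.univ.filter fun i => v i ≤ δ).card
  set S := Finset.univ.filter fun k : Fin n => (k : ℕ) < m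
  set U := ⋃ k ∈ S, particle c ε t v k
  have hUm : MeasurableSet U := S.measurableSet_biUnion fun k _ => measurableSet_particle c ε t v k
  have hU : volume.real U = m * ε := by
    rw [volume_biUnion_particle hε, card_lt_card_filter_le]
  have hUsub : U ⊆ Icc (c * t) (m * ε + δ + c * t) := by
    refine iUnion₂_subset fun k hk => ?_
    have hk : (k : ℕ) < m := by simpa [S] using hk
    have hkδ := (orderStatistics_le_iff v δ k).2 hk
    have hk0 : 0 ≤ orderStatistics v k := hv _
    have : ((k : ℕ) + 1) * ε ≤ m * ε := by
      gcongr
      exact_mod_cast hk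
    rw [particle_eq]
    refine Ioo_subset_Icc_self.trans (Icc_subset_Icc ?_ (by linarith))
    have : 0 ≤ ((k : ℕ) : ℝ) * ε := by positivity
    linarith
  -- The first `m` particles have total length `mε` inside an interval of length `mε + δ`.
  have hcompl : volume.real (Icc (c * t) (m * ε + δ + c * t) \ U) = δ := by
    have : 0 ≤ (m : ℝ) * ε := by positivity
    rw [measureReal_sdiff hUsub hUm measure_Icc_lt_top.ne, hU, Real.volume_real_Icc_of_le (by linarith)]
    ring
  have hrest : volume.real (Icc (x + c * t) (y + c * t) \ ⋃ k, particle c ε t v k) ≤ δ := by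
    rw [← hcompl]
    refine measureReal_mono (sdiff_subset_sdiff (Icc_subset_Icc (by linarith) (by linarith))
      (iUnion₂_subset fun k _ => subset_iUnion _ k)) ?_
    exact ((measure_mono sdiff_subset).trans_lt measure_Icc_lt_top).ne
  have hsum := measureReal_inter_add_sdiff (μ := volume) (s := Icc (x + c * t) (y + c * t))
    (MeasurableSet.iUnion fun k => measurableSet_particle c ε t v k) (by simp)
  rw [Real.volume_real_Icc_of_le (by linarith)] at hsum
  have hpos : 0 < y - x := by linarith
  rw [massDensity, le_div_iff₀ hpos, sub_mul, div_mul_cancel₀ _ hpos.ne']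
  linarith

/-- The particles whose value is at most `δ` do not reach `[x, y]` if `n ε + δ ≤ x`. -/
lemma massDensity_le {x y δ : ℝ} (hε : 0 ≤ ε) (hx : n * ε + δ ≤ x) (hxy : x < y) :
    massDensity c ε t v x y ≤ (n - (Finset.univ.filter fun i => v i ≤ δ).card) * ε / (y - x) := by
  have hpos : 0 < y - x := by linarith
  rw [massDensity]
  gcongr
  set m := (Finset.univ.filter fun i => v i ≤ δ).card with hm
  set S := Finset.univ.filter fun k : Fin n => ¬ (k : ℕ) < m with hS
  have hcard : (S.card : ℝ) = n - m := by
    have h := Finset.card_filter_add_card_filter_not (s := (Finset.univ : Finset (Fin n)))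
      fun k => (k : ℕ) < m
    rw [card_lt_card_filter_le, ← hm, ← hS, Finset.card_fin] at h
    have h' : (m : ℝ) + S.card = n := by exact_mod_cast h
    linarith
  rw [← hcard, ← volume_biUnion_particle (c := c) (t := t) (v := v) hε S]
  refine measureReal_mono ?_ ?_
  · rintro z ⟨hz, hzU⟩
    obtain ⟨k, hk⟩ := mem_iUnion.1 hzU
    refine mem_biUnion (x := k) ?_ hk
    simp only [hS, Finset.coe_filter, Finset.mem_univ, true_and, mem_ofPred_eq]
    intro hkm
    have hkδ := (orderStatistics_le_iff v δ k).2 hkm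
    rw [particle_eq] at hk
    have : ((k : ℕ) + 1) * ε ≤ n * ε := by
      gcongr
      exact_mod_cast k.isLt
    linarith [hk.2, hz.1]
  · refine ((measure_biUnion_finset_le _ _).trans_lt ?_).ne
    simp [volume_particle, ENNReal.mul_lt_top]

end Geometry

/-! ### Tails at a fixed time and the number of large values -/

lemma expMeasure_Ioi_le {r : ℝ} (hr : 0 < r) (a : ℝ) :
    expMeasure r (Ioi a) ≤ ENNReal.ofReal (Real.exp (-(r * a))) := by
  have := isProbabilityMeasure_expMeasure hr
  rcases lt_or_ge a 0 with ha | ha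
  · refine prob_le_one.trans (ENNReal.one_le_ofReal.2 (Real.one_le_exp ?_))
    nlinarith
  · have h := cdf_expMeasure_eq hr a
    rw [if_pos ha, cdf_eq_real] at h
    rw [← compl_Iic, ← ofReal_measureReal, probReal_compl_eq_one_sub measurableSet_Iic, h,
      sub_sub_cancel]

/-- At any time, the drifted reflected Brownian motion started from the exponential distribution
has an exponential tail. -/
lemma measure_lt_reflected_le [IsProbabilityMeasure P] {c : ℝ} (hc : 0 < c) {B Z : ℝ≥0 → Ω → ℝ}
    (hB : IsBrownianReal B P) (hZ : IsReflectedDriftedBM P c B Z)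
    (h0 : HasLaw (Z 0) (expMeasure (2 * c)) P) (hind : IndepFun (Z 0) (fun ω t => B t ω) P)
    (t : ℝ≥0) (a : ℝ) :
    P {ω | a < Z t ω} ≤ 2 * ENNReal.ofReal (Real.exp (-(2 * c * a))) := by
  have htail : ∀ a, P {ω | a < Z 0 ω} ≤ ENNReal.ofReal (Real.exp (-(2 * c * a))) := fun a => by
    rw [h0.measure_eq (p := fun z => a < z) measurableSet_Ioi]
    exact expMeasure_Ioi_le (by positivity) a
  have hfree := measure_lt_add_gaussian_le h0.aemeasurable (hB.hasLaw_eval t)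
    (hind.comp measurable_id (measurable_pi_apply (X := fun _ : ℝ≥0 => ℝ) t)) htail a
  have hrefl := measure_exists_lt_sub_le hB.toIsPreBrownianReal hc.le t a
  rw [two_mul]
  refine (measure_mono_ae ?_).trans ((measure_union_le _ _).trans (add_le_add hfree hrefl))
  filter_upwards [hB.cont, hZ, hB.eval_zero_ae_eq_zero] with ω hcont hω hB0 hlt
  obtain ⟨s, hst, hs, heq⟩ := hω.exists_last_zero (by fun_prop) t
  have hlt : a < Z t ω := hlt
  rcases hs with rfl | hs
  · refine Or.inl ?_
    simp only [hB0, NNReal.coe_zero] at heq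
    change a < Z 0 ω + B t ω - c * t
    linarith
  · refine Or.inr ⟨hcont, s, hst, ?_⟩
    linarith

/-- Markov's inequality for the number of events that occur. -/
lemma measure_lt_card_filter_le [IsProbabilityMeasure P] {n : ℕ} {A : Fin n → Set Ω} {g η : ℝ}
    (hη : 0 < η) (hn : 0 < n) (hA : ∀ k, P (A k) ≤ ENNReal.ofReal g) [∀ ω, DecidablePred (ω ∈ A ·)] :
    P {ω | η * n ≤ (Finset.univ.filter fun k => ω ∈ A k).card} ≤ ENNReal.ofReal (g / η) := by
  have hn' : (0 : ℝ) < n := by exact_mod_cast hn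
  -- The events `A k` need not be measurable, so they are replaced by measurable hulls.
  set f : Ω → ENNReal := fun ω => ∑ k, (toMeasurable P (A k)).indicator 1 ω
  have hf : ∫⁻ ω, f ω ∂P ≤ ENNReal.ofReal (n * g) := by
    rw [lintegral_finsetSum _ fun k _ =>
      measurable_one.indicator (measurableSet_toMeasurable P (A k))]
    simp only [lintegral_indicator_one (measurableSet_toMeasurable P (A _)), measure_toMeasurable]
    refine (Finset.sum_le_sum fun k _ => hA k).trans_eq ?_
    rw [Finset.sum_const, Finset.card_fin, nsmul_eq_mul, ENNReal.ofReal_mul hn'.le,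
      ENNReal.ofReal_natCast]
  have hfm : Measurable f := Finset.measurable_fun_sum _ fun k _ =>
    measurable_one.indicator (measurableSet_toMeasurable P (A k))
  calc _ ≤ P {ω | ENNReal.ofReal (η * n) ≤ f ω} := by
        refine measure_mono fun ω hω => ?_
        refine (ENNReal.ofReal_le_ofReal hω).trans ?_
        rw [ENNReal.ofReal_natCast, Finset.card_filter]
        push_cast
        refine Finset.sum_le_sum fun k _ => ?_
        split_ifs with h
        · rw [indicator_of_mem (subset_toMeasurable P (A k) h)]
          rfl
        · exact zero_le
    _ ≤ (∫⁻ ω, f ω ∂P) / ENNReal.ofReal (η * n) :=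
        meas_ge_le_lintegral_div hfm.aemeasurable
          (ENNReal.ofReal_pos.2 (by positivity)).ne' ENNReal.ofReal_ne_top
    _ ≤ ENNReal.ofReal (n * g) / ENNReal.ofReal (η * n) := by gcongr
    _ = ENNReal.ofReal (g / η) := by
        rw [← ENNReal.ofReal_div_of_pos (by positivity)]
        congr 1
        field_simp

/-- With high probability, at any given time all but few of the reflected processes are near `0`. -/
lemma IsPseudoStationary.measure_configuration_ge [IsProbabilityMeasure P] {c δ η : ℝ}
    (hc : 0 < c) (hδ : 0 < δ) (hη : 0 < η) {n : ℕ} (hn : 0 < n) {B Z : Fin n → ℝ≥0 → Ω → ℝ}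
    (h : IsPseudoStationary P c B Z) (t : ℝ≥0) :
    1 - (c * δ * η)⁻¹ ≤ P.real {ω | (∀ k, 0 ≤ Z k t ω) ∧
      (1 - η) * n ≤ (Finset.univ.filter fun k => Z k t ω ≤ δ).card} := by
  classical
  set G := {ω | (∀ k, 0 ≤ Z k t ω) ∧
    (1 - η) * n ≤ (Finset.univ.filter fun k => Z k t ω ≤ δ).card}
  have hA : ∀ k, P {ω | δ < Z k t ω} ≤ ENNReal.ofReal (c * δ)⁻¹ := fun k => by
    refine (measure_lt_reflected_le hc (h.brownian k) (h.reflected k) (h.hasLaw_zero k)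
      (h.indep_start k) t δ).trans ?_
    rw [← ENNReal.ofReal_ofNat 2, ← ENNReal.ofReal_mul zero_le_two]
    refine ENNReal.ofReal_le_ofReal ?_
    -- The crude bound `2 exp(-2u) ≤ 1/u` with `u = cδ` suffices.
    have hexp := Real.add_one_le_exp (2 * c * δ)
    have hcδ : 0 < c * δ := by positivity
    rw [Real.exp_neg, ← div_eq_mul_inv, inv_eq_one_div, div_le_div_iff₀ (Real.exp_pos _) hcδ]
    linarith
  have hcard := measure_lt_card_filter_le hη hn hA
  have hcompl : P Gᶜ ≤ ENNReal.ofReal ((c * δ)⁻¹ / η) := by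
    refine (measure_mono_ae ?_).trans hcard
    filter_upwards [ae_all_iff.2 h.reflected] with ω hω hG
    have hpos : ∀ k, 0 ≤ Z k t ω := fun k => by
      obtain ⟨ℓ, -, -, -, hz, -⟩ := hω k
      exact hz t
    by_contra hlt
    refine hG ⟨hpos, ?_⟩
    have hlt : ((Finset.univ.filter fun k => δ < Z k t ω).card : ℝ) < η * n := not_le.1 hlt
    have hsum := Finset.card_filter_add_card_filter_not (s := (Finset.univ : Finset (Fin n)))
      fun k => Z k t ω ≤ δ
    simp only [not_le, Finset.card_fin] at hsum
    have hsum' : ((Finset.univ.filter fun k => Z k t ω ≤ δ).card : ℝ) +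
      (Finset.univ.filter fun k => δ < Z k t ω).card = n := by exact_mod_cast hsum
    linarith
  have hreal : P.real Gᶜ ≤ (c * δ * η)⁻¹ := by
    rw [mul_inv, ← div_eq_mul_inv]
    exact ENNReal.toReal_le_of_le_ofReal (by positivity) hcompl
  -- Subadditivity avoids having to know that `G` is measurable.
  have := measureReal_union_le (μ := P) G Gᶜ
  rw [union_compl_self, probReal_univ] at this
  linarith

end Crowding

theorem theorem2p1 (p₁ d₁ d₂ x₁ x₂ b x₃ x₄ : ℝ) (hp₁ : p₁ < 1) (hd₁ : d₁ < 1) (hd₂ : 0 < d₂)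
    (hx₁ : 0 ≤ x₁) (hx₁₂ : x₁ < x₂) (hx₂b : x₂ < b) (hbx₃ : b < x₃) (hx₃₄ : x₃ < x₄) :
    ∃ (c₀ : ℝ) (n₀ : ℕ), 0 < c₀ ∧ 0 < n₀ ∧
      ∀ (c : ℝ) (n : ℕ), c₀ ≤ c → n₀ ≤ n →
      ∀ (Ω : Type*) [MeasurableSpace Ω] (P : Measure Ω) [IsProbabilityMeasure P]
        (B Z : Fin n → ℝ≥0 → Ω → ℝ), Crowding.IsPseudoStationary P c B Z →
      ∀ t : ℝ≥0,
        p₁ ≤ P.real {ω | d₁ ≤ Crowding.massDensity c (b / n) t (fun k => Z k t ω) x₁ x₂} ∧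
        p₁ ≤ P.real {ω | Crowding.massDensity c (b / n) t (fun k => Z k t ω) x₃ x₄ ≤ d₂} := by
  have hb : 0 < b := by linarith
  -- `δ` bounds both the uncovered length in `[x₁, x₂]` and the overshoot beyond `b`. `η` ensures
  -- `x₂ ≤ (1 - η) b` and that the remaining mass `η b` is at most `d₂ (x₄ - x₃)`.
  set δ := min ((1 - d₁) * (x₂ - x₁)) (x₃ - b) with hδdef
  set η := min ((b - x₂) / b) (d₂ * (x₄ - x₃) / b) with hηdef
  have hδ : 0 < δ := lt_min (mul_pos (by linarith) (by linarith)) (by linarith)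
  have hη : 0 < η :=
    lt_min (div_pos (by linarith) hb) (div_pos (mul_pos hd₂ (by linarith)) hb)
  have hηb₁ : η * b ≤ b - x₂ := (le_div_iff₀ hb).1 (min_le_left _ _)
  have hηb₂ : η * b ≤ d₂ * (x₄ - x₃) := (le_div_iff₀ hb).1 (min_le_right _ _)
  have hp : 0 < 1 - p₁ := by linarith
  -- This `c₀` makes the failure bound `(cδη)⁻¹` at most `1 - p₁`. That bound is free of `n`, so `n₀
  -- = 1` works.
  refine ⟨(δ * η * (1 - p₁))⁻¹, 1, by positivity, one_pos, ?_⟩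
  intro c n hc hn Ω _ P _ B Z h t
  have hc0 : 0 < c := lt_of_lt_of_le (by positivity) hc
  have hprob : p₁ ≤ 1 - (c * δ * η)⁻¹ := by
    have : (c * δ * η)⁻¹ ≤ 1 - p₁ := by
      rw [inv_le_iff_one_le_mul₀ (by positivity)] at hc ⊢
      linarith
    linarith
  have hG := hprob.trans (h.measure_configuration_ge hc0 hδ hη hn t)
  have hn0 : (0 : ℝ) < n := by exact_mod_cast hn
  have hε : 0 ≤ b / n := by positivity
  have hnb : n * (b / n) = b := by field_simp
  refine ⟨hG.trans (measureReal_mono ?_), hG.trans (measureReal_mono ?_)⟩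
  · rintro ω ⟨hpos, hcard⟩
    have hm := mul_le_mul_of_nonneg_right hcard hε
    rw [mul_assoc, hnb] at hm
    refine le_trans ?_ (Crowding.le_massDensity hε hδ.le hpos hx₁ hx₁₂ (by linarith))
    rw [le_sub_comm, div_le_iff₀ (by linarith)]
    exact min_le_left _ _
  · rintro ω ⟨-, hcard⟩
    have hm := mul_le_mul_of_nonneg_right hcard hε
    rw [mul_assoc, hnb] at hm
    refine (Crowding.massDensity_le (δ := δ) hε ?_ hx₃₄).trans ?_
    · rw [hnb]
      linarith [min_le_right ((1 - d₁) * (x₂ - x₁)) (x₃ - b)]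
    · rw [div_le_iff₀ (by linarith), sub_mul, hnb]
      linarith
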